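/- Let $\mathbb{C}_+=\{z\in\mathbb{C}:\operatorname{Im}z>0\}$, and for $z\in\mathbb{C}_+$ let $\operatorname{Arg}z\in(0,\pi)$ be its principal argument. A real Jacobi matrix is a real symmetric tridiagonal matrix with diagonal entries $b_1,\dots,b_n\in\mathbb{R}$ and entries $a_1,\dots,a_{n-1}\ge 0$ directly above and below the diagonal. Let $I_{1\times1}$ denote the square matrix (of the relevant size) with $(1,1)$-entry equal to $1$ and all other entries $0$. (i) Let $n\ge1$. Consider the matrices $\mathcal{J}_l=\mathcal{J}+il\,I_{1\times1}$, where $l>0$ and $\mathcal{J}$ is an $n\times n$ positive definite real Jacobi matrix with $a_j>0$ for $j=1,\dots,n-1$. The eigenvalues $z_1,\dots,z_n$ of any such $\mathcal{J}_l$, counted with algebraic multiplicity, belong to $$\Big\{(z_j)_{j=1}^n\in(\mathbb{C}_+)^n:\ \sum_{j=1}^n\operatorname{Arg}z_j<\tfrac{\pi}{2}\Big\}.$$ Moreover, for every $(z_j)_{j=1}^n$ in this set there exists a unique matrix $\mathcal{J}_l$ of the above form whose eigenvalues, counted with algebraic multiplicity, are $z_1,\dots,z_n$. (ii) Let $m\ge0$.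 Consider the matrices $\mathcal{J}_l=\mathcal{J}+il\,I_{1\times1}$, where $l>0$ and $\mathcal{J}$ is an $(m+1)\times(m+1)$ positive semidefinite real Jacobi matrix with $a_j>0$ for $j=1,\dots,m$ and $\det\mathcal{J}=0$. The eigenvalues $z_1,\dots,z_{m+1}$ of any such $\mathcal{J}_l$, counted with algebraic multiplicity, belong to $$\Big\{(z_j)_{j=1}^{m+1}\in(\mathbb{C}_+)^{m+1}:\ \sum_{j=1}^{m+1}\operatorname{Arg}z_j=\tfrac{\pi}{2}\Big\}.$$ Moreover, for every $(z_j)_{j=1}^{m+1}$ in this set there exists a unique matrix $\mathcal{J}_l$ of the above form whose eigenvalues, counted with algebraic multiplicity, are $z_1,\dots,z_{m+1}$. -/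

import Mathlib

/-- A real Jacobi matrix: symmetric, tridiagonal, with nonnegative entries `a_j` right above
(and, by symmetry, right below) the diagonal. -/
structure IsJacobi {n : ℕ} (J : Matrix (Fin n) (Fin n) ℝ) : Prop where
  symm : J.IsSymm
  tridiagonal : ∀ i j : Fin n, (i : ℕ) + 1 < (j : ℕ) → J i j = 0
  offDiag_nonneg : ∀ i j : Fin n, (i : ℕ) + 1 = (j : ℕ) → 0 ≤ J i j

/-- A real Jacobi matrix all of whose off-diagonal Jacobi coefficients `a_j` are positive. -/
def IsStrictJacobi {n : ℕ} (J : Matrix (Fin n) (Fin n) ℝ) : Prop :=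
  IsJacobi J ∧ ∀ i j : Fin n, (i : ℕ) + 1 = (j : ℕ) → 0 < J i j

/-- The `n × n` matrix with top left entry `1` and all other entries `0`. -/
def cornerMatrix (n : ℕ) : Matrix (Fin n) (Fin n) ℂ :=
  Matrix.of fun i j => if (i : ℕ) = 0 ∧ (j : ℕ) = 0 then 1 else 0

/-- The complex matrix `J + i l I_{1×1}`. -/
noncomputable def jacobiPerturbation {n : ℕ} (J : Matrix (Fin n) (Fin n) ℝ) (l : ℝ) :
    Matrix (Fin n) (Fin n) ℂ :=
  J.map (fun x : ℝ => (x : ℂ)) + (Complex.I * (l : ℂ)) • cornerMatrix n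

/-- The matrices `J + i l I_{1×1}` with `l > 0` and `J` a positive definite real Jacobi matrix
with all `a_j > 0`. -/
def definiteModels (n : ℕ) : Set (Matrix (Fin n) (Fin n) ℂ) :=
  {M | ∃ (J : Matrix (Fin n) (Fin n) ℝ) (l : ℝ),
    IsStrictJacobi J ∧ J.PosDef ∧ 0 < l ∧ M = jacobiPerturbation J l}

/-- The matrices `J + i l I_{1×1}` with `l > 0` and `J` a singular positive semidefinite real
Jacobi matrix with all `a_j > 0`. -/
def singularModels (n : ℕ) : Set (Matrix (Fin n) (Fin n) ℂ) :=
  {M | ∃ (J : Matrix (Fin n) (Fin n) ℝ) (l : ℝ),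
    IsStrictJacobi J ∧ J.PosSemidef ∧ J.det = 0 ∧ 0 < l ∧ M = jacobiPerturbation J l}

/-- `z` lists the eigenvalues of `M`, counted with algebraic multiplicity (in some order). -/
def IsEigenvalueSystem {n : ℕ} (M : Matrix (Fin n) (Fin n) ℂ) (z : Fin n → ℂ) : Prop :=
  M.charpoly.roots = (Finset.univ : Finset (Fin n)).val.map z

/-- The `n`-tuples of points of the open upper half-plane whose arguments add up to less
than `π / 2`. -/
def configLT (n : ℕ) : Set (Fin n → ℂ) :=
  {z | (∀ j, 0 < (z j).im) ∧ ∑ j, (z j).arg < Real.pi / 2}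

/-- The `n`-tuples of points of the open upper half-plane whose arguments add up to exactly
`π / 2`. -/
def configEQ (n : ℕ) : Set (Fin n → ℂ) :=
  {z | (∀ j, 0 < (z j).im) ∧ ∑ j, (z j).arg = Real.pi / 2}

/-! Write P for the characteristic polynomial of 𝒥 and Q for that of 𝒥 with its first row and column
deleted. The characteristic polynomial of 𝒥_l is f = P - ilQ, so the real and imaginary parts of the
coefficients of f give back P, l and Q (Q is monic). Since P = (X - b)Q - a²R, with R the next
truncation, the pair (P, Q) determines 𝒥 entry by entry (`IsStrictJacobi.eq_of_charpoly_eq`). This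
is uniqueness.

The recurrence also propagates Im (P/Q) ≤ 0 on Im z ≤ 0, which excludes roots of f there.
Conversely, if all roots of f lie in the open upper half-plane, a Hermite–Biehler argument shows
that Q has simple real roots and that R/Q has positive residues. So a² > 0 and the pair (Q, R)
satisfies the same hypothesis; recursion builds 𝒥 (`exists_isStrictJacobi`).

It remains to read off positivity. For real x, P(x) = Re f(x) equals, up to sign and a positive
factor, cos (∑ Arg(z_j - x)). This sum increases strictly from 0 at -∞, so the smallest eigenvalue
of 𝒥 is where it equals π/2. Comparing with its value at x = 0 gives both cases. -/

open Polynomial Filter Topology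

/-! ### Determinants with a modified corner or a sparse first row and column -/

namespace Matrix

variable {R : Type*} [CommRing R]

/-- Changing the corner entry of a matrix changes its determinant by the corresponding multiple
of the complementary minor. -/
theorem det_eq_add_of_eq_off_corner {n : ℕ} (A B : Matrix (Fin (n + 1)) (Fin (n + 1)) R)
    (h0 : ∀ j : Fin n, A 0 j.succ = B 0 j.succ) (h1 : ∀ i j, A (Fin.succ i) j = B i.succ j) :
    A.det = B.det + (A 0 0 - B 0 0) * (B.submatrix Fin.succ Fin.succ).det := by
  have hs : ∀ f : Fin n → Fin (n + 1), A.submatrix Fin.succ f = B.submatrix Fin.succ f := by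
    intro f; ext i j; simp [h1]
  rw [det_succ_row_zero, det_succ_row_zero B, Fin.sum_univ_succ, Fin.sum_univ_succ]
  simp only [hs, h0]
  simp
  ring

/-- The three-term recurrence for determinants with sparse first row and column. -/
theorem det_of_sparse_first {n : ℕ} (A : Matrix (Fin (n + 2)) (Fin (n + 2)) R)
    (h0 : ∀ j : Fin n, A 0 j.succ.succ = 0) (h1 : ∀ i : Fin n, A i.succ.succ 0 = 0) :
    A.det = A 0 0 * (A.submatrix Fin.succ Fin.succ).det
      - A 0 1 * A 1 0 * ((A.submatrix Fin.succ Fin.succ).submatrix Fin.succ Fin.succ).det := by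
  rw [det_succ_row_zero, Fin.sum_univ_succ, Fin.sum_univ_succ]
  have h2 : (A.submatrix Fin.succ (Fin.succAbove 1)).det
      = A 1 0 * ((A.submatrix Fin.succ Fin.succ).submatrix Fin.succ Fin.succ).det := by
    rw [det_succ_column_zero, Fin.sum_univ_succ]
    have h3 : (fun i : Fin n => (Fin.succAbove (1 : Fin (n + 2)) i.succ)) = fun i => i.succ.succ := by
      ext i
      rw [← Fin.succ_zero_eq_one, Fin.succ_succAbove_succ, Fin.succAbove_zero]
    simp only [submatrix_apply, Fin.one_succAbove_zero, h1, submatrix_submatrix]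
    simp only [Fin.succAbove_zero]
    simp only [Function.comp_def, h3]
    simp
  simp only [h0]
  simp [h2]
  ring

theorem submatrix_charmatrix {m n : Type*} [DecidableEq m] [Fintype m] [DecidableEq n] [Fintype n]
    (A : Matrix n n R) (f : m → n) (hf : Function.Injective f) :
    (charmatrix A).submatrix f f = charmatrix (A.submatrix f f) := by
  ext i j : 2
  simp [charmatrix_apply, diagonal_apply, hf.eq_iff]

end Matrix

/-! ### Truncations of Jacobi matrices and their characteristic polynomials -/

/-- The matrix obtained by deleting the first row and the first column. -/
def Matrix.tail {R : Type*} {n : ℕ} (A : Matrix (Fin (n + 1)) (Fin (n + 1)) R) :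
    Matrix (Fin n) (Fin n) R :=
  A.submatrix Fin.succ Fin.succ

theorem IsStrictJacobi.tail {n : ℕ} {J : Matrix (Fin (n + 1)) (Fin (n + 1)) ℝ}
    (hJ : IsStrictJacobi J) : IsStrictJacobi J.tail := by
  obtain ⟨⟨h1, h2, h3⟩, h4⟩ := hJ
  refine ⟨⟨?_, fun i j h => ?_, fun i j h => ?_⟩, fun i j h => ?_⟩
  · exact h1.submatrix _
  · exact h2 _ _ (by simpa using h)
  · exact h3 _ _ (by simpa using h)
  · exact h4 _ _ (by simpa using h)

theorem IsStrictJacobi.apply_zero_succ_succ {n : ℕ} {J : Matrix (Fin (n + 2)) (Fin (n + 2)) ℝ}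
    (hJ : IsStrictJacobi J) (j : Fin n) : J 0 j.succ.succ = 0 :=
  hJ.1.tridiagonal _ _ (by simp)

theorem IsStrictJacobi.apply_succ_succ_zero {n : ℕ} {J : Matrix (Fin (n + 2)) (Fin (n + 2)) ℝ}
    (hJ : IsStrictJacobi J) (j : Fin n) : J j.succ.succ 0 = 0 := by
  rw [hJ.1.symm.apply]; exact hJ.apply_zero_succ_succ j

theorem IsStrictJacobi.apply_one_zero {n : ℕ} {J : Matrix (Fin (n + 2)) (Fin (n + 2)) ℝ}
    (hJ : IsStrictJacobi J) : J 1 0 = J 0 1 := hJ.1.symm.apply _ _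

theorem IsStrictJacobi.apply_zero_one_pos {n : ℕ} {J : Matrix (Fin (n + 2)) (Fin (n + 2)) ℝ}
    (hJ : IsStrictJacobi J) : 0 < J 0 1 := hJ.2 _ _ (by simp)

/-- The three-term recurrence for the characteristic polynomials of a Jacobi matrix. -/
theorem IsStrictJacobi.charpoly_eq {n : ℕ} {J : Matrix (Fin (n + 2)) (Fin (n + 2)) ℝ}
    (hJ : IsStrictJacobi J) :
    J.charpoly = (X - C (J 0 0)) * J.tail.charpoly - C (J 0 1 ^ 2) * J.tail.tail.charpoly := by
  unfold Matrix.charpoly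
  rw [Matrix.det_of_sparse_first]
  · rw [Matrix.submatrix_charmatrix _ _ (Fin.succ_injective _),
      Matrix.submatrix_charmatrix _ _ (Fin.succ_injective _)]
    simp [Matrix.tail, hJ.apply_one_zero, sq]
  · intro j
    rw [Matrix.charmatrix_apply_ne _ _ _ (Fin.succ_ne_zero _).symm, hJ.apply_zero_succ_succ]; simp
  · intro j
    rw [Matrix.charmatrix_apply_ne _ _ _ (Fin.succ_ne_zero _), hJ.apply_succ_succ_zero]; simp

/-- The characteristic polynomial of `J + i l I_{1×1}` in terms of those of `J` and its tail. -/
theorem charpoly_jacobiPerturbation {n : ℕ} (J : Matrix (Fin (n + 1)) (Fin (n + 1)) ℝ) (l : ℝ) :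
    (jacobiPerturbation J l).charpoly = J.charpoly.map Complex.ofRealHom
      - C (Complex.I * l) * J.tail.charpoly.map Complex.ofRealHom := by
  rw [← Matrix.charpoly_map, ← Matrix.charpoly_map]
  unfold Matrix.charpoly
  rw [Matrix.det_eq_add_of_eq_off_corner _ (J.map Complex.ofRealHom).charmatrix]
  · rw [Matrix.submatrix_charmatrix _ _ (Fin.succ_injective _)]
    simp [Matrix.tail, jacobiPerturbation, cornerMatrix,
      Matrix.submatrix_map]
    ring
  · intro j
    simp [Matrix.charmatrix_apply, jacobiPerturbation, cornerMatrix]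
  · intro i j
    simp [Matrix.charmatrix_apply, jacobiPerturbation, cornerMatrix]

theorem eval_charpoly_jacobiPerturbation {n : ℕ} (J : Matrix (Fin (n + 1)) (Fin (n + 1)) ℝ) (l : ℝ)
    (z : ℂ) : (jacobiPerturbation J l).charpoly.eval z
      = aeval z J.charpoly - Complex.I * l * aeval z J.tail.charpoly := by
  rw [charpoly_jacobiPerturbation]
  simp [eval_map, aeval_def]
  rfl

theorem charpoly_fin_one (J : Matrix (Fin 1) (Fin 1) ℝ) : J.charpoly = X - C (J 0 0) := by
  simp [Matrix.charpoly]

/-! ### Eigenvalues lie in the upper half-plane -/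

/-- The division-free form of Im (P/Q) ≤ 0. The recurrence gives Im (P Q̄) = Im z · |Q|² + a² Im (Q
R̄), and induction handles the last term. A common zero of P and Q would also be one of Q and R, as
a ≠ 0. -/
theorem IsStrictJacobi.im_mul_conj_nonpos {n : ℕ} {J : Matrix (Fin (n + 1)) (Fin (n + 1)) ℝ}
    (hJ : IsStrictJacobi J) {z : ℂ} (hz : z.im ≤ 0) :
    (aeval z J.charpoly * (starRingEnd ℂ) (aeval z J.tail.charpoly)).im ≤ 0 ∧
      ¬ (aeval z J.charpoly = 0 ∧ aeval z J.tail.charpoly = 0) := by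
  induction n with
  | zero =>
    rw [charpoly_fin_one]
    simpa using hz
  | succ n ih =>
    obtain ⟨h1, h2⟩ := ih hJ.tail
    have ha := hJ.apply_zero_one_pos
    rw [hJ.charpoly_eq]
    simp only [map_sub, map_mul, aeval_X, aeval_C]
    generalize aeval z J.tail.charpoly = q at *
    generalize aeval z J.tail.tail.charpoly = r at *
    have ha2 : 0 < J 0 1 ^ 2 := by positivity
    generalize J 0 1 ^ 2 = c at *
    generalize J 0 0 = b at *
    constructor
    · simp only [Complex.mul_im, Complex.conj_re, Complex.conj_im, Complex.sub_im, Complex.sub_re,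
        Complex.mul_re, Complex.coe_algebraMap, Complex.ofReal_re, Complex.ofReal_im] at h1 ⊢
      have : 0 ≤ q.re ^ 2 + q.im ^ 2 := by positivity
      nlinarith [mul_nonneg this (neg_nonneg.2 hz), mul_nonneg ha2.le (neg_nonneg.2 h1)]
    · rintro ⟨h3, h4⟩
      apply h2
      refine ⟨h4, ?_⟩
      simpa [h4, ha2.ne'] using h3

/-- At a root P = ilQ, so Im (P Q̄) = l|Q|². If Im z ≤ 0 this is also nonpositive, hence Q = P = 0,
which is impossible. -/
theorem IsStrictJacobi.im_pos_of_isRoot {n : ℕ} {J : Matrix (Fin (n + 1)) (Fin (n + 1)) ℝ}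
    (hJ : IsStrictJacobi J) {l : ℝ} (hl : 0 < l) {z : ℂ}
    (hz : (jacobiPerturbation J l).charpoly.IsRoot z) : 0 < z.im := by
  by_contra! h
  obtain ⟨h1, h2⟩ := hJ.im_mul_conj_nonpos h
  rw [IsRoot, eval_charpoly_jacobiPerturbation, sub_eq_zero] at hz
  apply h2
  rw [hz] at h1 ⊢
  generalize aeval z J.tail.charpoly = q at *
  have h3 : l * (q.re ^ 2 + q.im ^ 2) ≤ 0 := by
    simp at h1
    nlinarith
  have h4 : q.re ^ 2 + q.im ^ 2 ≤ 0 := by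
    by_contra! h5
    exact absurd h3 (not_le.2 (mul_pos hl h5))
  have h5 : q = 0 := by
    apply Complex.ext <;> simp <;> nlinarith [sq_nonneg q.re, sq_nonneg q.im]
  simp [h5]

/-! ### Recovering and extending a Jacobi matrix -/

/-- A strict Jacobi matrix is determined by its characteristic polynomial and that of its tail. -/
theorem IsStrictJacobi.eq_of_charpoly_eq {n : ℕ} {J K : Matrix (Fin (n + 1)) (Fin (n + 1)) ℝ}
    (hJ : IsStrictJacobi J) (hK : IsStrictJacobi K) (h : J.charpoly = K.charpoly)
    (ht : J.tail.charpoly = K.tail.charpoly) : J = K := by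
  induction n with
  | zero =>
    rw [charpoly_fin_one, charpoly_fin_one] at h
    ext i j
    fin_cases i; fin_cases j
    simpa using h
  | succ n ih =>
    have hq := J.tail.charpoly_monic
    have hqd : J.tail.charpoly.natDegree = n + 1 := by simp [Matrix.charpoly_natDegree_eq_dim]
    have hqc : J.tail.charpoly.coeff (n + 1) = 1 := by
      have := hq.coeff_natDegree
      rwa [hqd] at this
    have hd : ∀ A : Matrix (Fin n) (Fin n) ℝ, A.charpoly.natDegree = n := by
      simp [Matrix.charpoly_natDegree_eq_dim]
    have key := h
    rw [hJ.charpoly_eq, hK.charpoly_eq, ← ht] at key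
    have h1 : C (K 0 0 - J 0 0) * J.tail.charpoly
        = C (J 0 1 ^ 2) * J.tail.tail.charpoly - C (K 0 1 ^ 2) * K.tail.tail.charpoly := by
      rw [C_sub]; linear_combination key
    -- The right side of `h1` has degree at most n, while the tail's polynomial is monic of degree n
    -- + 1.
    have hb : J 0 0 = K 0 0 := by
      have := congrArg (fun p => p.coeff (n + 1)) h1
      simp only [coeff_C_mul, coeff_sub] at this
      rw [hqc, coeff_eq_zero_of_natDegree_lt (by rw [hd]; omega),
        coeff_eq_zero_of_natDegree_lt (by rw [hd]; omega)] at this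
      linarith
    have h2 : C (J 0 1 ^ 2) * J.tail.tail.charpoly = C (K 0 1 ^ 2) * K.tail.tail.charpoly := by
      rw [hb] at h1; simp at h1; simp; linear_combination -h1
    have ha2 : J 0 1 ^ 2 = K 0 1 ^ 2 := by
      have := congrArg leadingCoeff h2
      simpa [(Matrix.charpoly_monic _).leadingCoeff] using this
    have ha : J 0 1 = K 0 1 :=
      (sq_eq_sq₀ hJ.apply_zero_one_pos.le hK.apply_zero_one_pos.le).1 ha2
    have h3 : J.tail.tail.charpoly = K.tail.tail.charpoly := by
      rw [← ha2] at h2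
      exact mul_left_cancel₀ (by simpa using hJ.apply_zero_one_pos.ne') h2
    have h4 := ih hJ.tail hK.tail ht h3
    ext i j
    refine Fin.cases ?_ (fun i => ?_) i <;> refine Fin.cases ?_ (fun j => ?_) j
    · exact hb
    · refine Fin.cases ?_ (fun j => ?_) j
      · exact ha
      · rw [hJ.apply_zero_succ_succ, hK.apply_zero_succ_succ]
    · refine Fin.cases ?_ (fun i => ?_) i
      · exact hJ.apply_one_zero.trans (ha.trans hK.apply_one_zero.symm)
      · rw [hJ.apply_succ_succ_zero, hK.apply_succ_succ_zero]
    · exact congrFun (congrFun h4 i) j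

/-- Adjoining a first row and column to a Jacobi matrix. -/
theorem IsStrictJacobi.exists_border {n : ℕ} {J : Matrix (Fin (n + 1)) (Fin (n + 1)) ℝ}
    (hJ : IsStrictJacobi J) (b : ℝ) {a : ℝ} (ha : 0 < a) :
    ∃ K : Matrix (Fin (n + 2)) (Fin (n + 2)) ℝ,
      IsStrictJacobi K ∧ K.tail = J ∧ K 0 0 = b ∧ K 0 1 = a := by
  let v : Fin (n + 1) → ℝ := Fin.cons a 0
  let K : Matrix (Fin (n + 2)) (Fin (n + 2)) ℝ :=
    Matrix.of (Fin.cons (Fin.cons b v) fun i => Fin.cons (v i) (J i))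
  have h00 : K 0 0 = b := rfl
  have h0s : ∀ j : Fin (n + 1), K 0 j.succ = v j := fun j => rfl
  have hs0 : ∀ j : Fin (n + 1), K j.succ 0 = v j := fun j => rfl
  have hss : ∀ i j : Fin (n + 1), K i.succ j.succ = J i j := fun i j => rfl
  have v0 : v 0 = a := rfl
  have vs : ∀ j : Fin n, v j.succ = 0 := fun j => rfl
  have hp : ∀ i j : Fin (n + 2), (i : ℕ) + 1 = (j : ℕ) → 0 < K i j := by
    intro i j
    refine Fin.cases ?_ (fun i => ?_) i <;> refine Fin.cases ?_ (fun j => ?_) j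
    · simp
    · refine Fin.cases ?_ (fun j => ?_) j
      · intro; rw [h0s, v0]; exact ha
      · simp
    · simp
    · intro h; rw [hss]; exact hJ.2 _ _ (by simpa using h)
  refine ⟨K, ⟨⟨?_, ?_, fun i j h => (hp i j h).le⟩, hp⟩, rfl, rfl, rfl⟩
  · apply Matrix.IsSymm.ext
    intro i j
    refine Fin.cases ?_ (fun i => ?_) i <;> refine Fin.cases ?_ (fun j => ?_) j
    · rfl
    · rfl
    · rfl
    · rw [hss, hss, hJ.1.symm.apply]
  · intro i j
    refine Fin.cases ?_ (fun i => ?_) i <;> refine Fin.cases ?_ (fun j => ?_) j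
    · simp
    · refine Fin.cases ?_ (fun j => ?_) j
      · simp
      · intro; rw [h0s, vs]
    · simp
    · intro h; rw [hss]; exact hJ.1.tridiagonal _ _ (by simpa using h)

/-! ### Polynomials with all roots in the upper half-plane -/

theorem Polynomial.eval_map_complex_ofRealHom (p : ℝ[X]) (z : ℂ) :
    (p.map Complex.ofRealHom).eval z = aeval z p := by
  rw [eval_map, aeval_def]; rfl

theorem Polynomial.aeval_complex_ofReal (p : ℝ[X]) (x : ℝ) :
    aeval (x : ℂ) p = (p.eval x : ℝ) := by
  rw [← eval_map_complex_ofRealHom]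
  exact eval_map_apply Complex.ofRealHom x

/-- A nonconstant monic polynomial with all roots in the upper half-plane is smaller at points
of the upper half-plane than at their conjugates. -/
theorem norm_eval_lt_norm_eval_conj {f : ℂ[X]} (hf : f.Monic) (hd : f.natDegree ≠ 0)
    (hr : ∀ w, f.IsRoot w → 0 < w.im) {z : ℂ} (hz : 0 < z.im) :
    ‖f.eval z‖ < ‖f.eval ((starRingEnd ℂ) z)‖ := by
  have hs : ∀ w ∈ f.roots, 0 < w.im := fun w hw => hr w (isRoot_of_mem_roots hw)
  have hne : f.roots ≠ 0 := by
    rw [← Multiset.card_pos, ← (IsAlgClosed.splits f).natDegree_eq_card_roots]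
    omega
  rw [(IsAlgClosed.splits f).eq_prod_roots_of_monic hf]
  have hlt : ∀ w : ℂ, 0 < w.im → ‖z - w‖ < ‖(starRingEnd ℂ) z - w‖ := by
    intro w hw
    rw [← sq_lt_sq₀ (norm_nonneg _) (norm_nonneg _), ← Complex.normSq_eq_norm_sq,
      ← Complex.normSq_eq_norm_sq, Complex.normSq_apply, Complex.normSq_apply]
    simp
    nlinarith [mul_pos hz hw]
  -- Strictness fails for the empty product, so the induction carries positivity and the weak
  -- inequality as well.
  have key : ∀ s : Multiset ℂ, (∀ w ∈ s, 0 < w.im) →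
      0 < ‖(s.map fun w => X - C w).prod.eval ((starRingEnd ℂ) z)‖ ∧
      ‖(s.map fun w => X - C w).prod.eval z‖
        ≤ ‖(s.map fun w => X - C w).prod.eval ((starRingEnd ℂ) z)‖ ∧
      (s ≠ 0 → ‖(s.map fun w => X - C w).prod.eval z‖
        < ‖(s.map fun w => X - C w).prod.eval ((starRingEnd ℂ) z)‖) := by
    intro s
    induction s using Multiset.induction with
    | empty => simp
    | cons a s ih =>
      intro h
      obtain ⟨h1, h2, -⟩ := ih fun w hw => h w (Multiset.mem_cons_of_mem hw)
      have h3 := hlt a (h a (Multiset.mem_cons_self a s))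
      have h4 := mul_lt_mul_of_lt_of_le_of_nonneg_of_pos h3 h2 (norm_nonneg _) h1
      simp only [Multiset.map_cons, Multiset.prod_cons, eval_mul, eval_sub, eval_X, eval_C,
        norm_mul]
      exact ⟨mul_pos ((norm_nonneg _).trans_lt h3) h1, h4.le, fun _ => h4⟩
  exact (key _ hs).2.2 hne

/-- For a nonconstant monic polynomial with all roots in the upper half-plane, the argument
strictly increases along the real line. -/
theorem im_eval_derivative_mul_conj_pos {f : ℂ[X]} (hf : f.Monic) (hd : f.natDegree ≠ 0)
    (hr : ∀ w, f.IsRoot w → 0 < w.im) (x : ℝ) :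
    0 < (f.derivative.eval (x : ℂ) * (starRingEnd ℂ) (f.eval (x : ℂ))).im := by
  have hs : ∀ w ∈ f.roots, 0 < w.im := fun w hw => hr w (isRoot_of_mem_roots hw)
  have hne : f.roots ≠ 0 := by
    rw [← Multiset.card_pos, ← (IsAlgClosed.splits f).natDegree_eq_card_roots]
    omega
  rw [(IsAlgClosed.splits f).eq_prod_roots_of_monic hf]
  have key : ∀ s : Multiset ℂ, (∀ w ∈ s, 0 < w.im) →
      0 < Complex.normSq ((s.map fun w => X - C w).prod.eval (x : ℂ)) ∧
      0 ≤ ((s.map fun w => X - C w).prod.derivative.eval (x : ℂ) *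
        (starRingEnd ℂ) ((s.map fun w => X - C w).prod.eval (x : ℂ))).im ∧
      (s ≠ 0 → 0 < ((s.map fun w => X - C w).prod.derivative.eval (x : ℂ) *
        (starRingEnd ℂ) ((s.map fun w => X - C w).prod.eval (x : ℂ))).im) := by
    intro s
    induction s using Multiset.induction with
    | empty => simp
    | cons a s ih =>
      intro h
      obtain ⟨h1, h2, -⟩ := ih fun w hw => h w (Multiset.mem_cons_of_mem hw)
      have ha := h a (Multiset.mem_cons_self a s)
      simp only [Multiset.map_cons, Multiset.prod_cons, eval_mul, eval_sub, eval_X, eval_C,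
        derivative_mul, eval_add, derivative_sub, derivative_X, derivative_C, sub_zero, one_mul,
        map_mul]
      generalize eval (x : ℂ) (Multiset.map (fun w => X - C w) s).prod = g at *
      generalize eval (x : ℂ) (derivative (Multiset.map (fun w => X - C w) s).prod) = g' at *
      have h3 : 0 < Complex.normSq (x - a) := by
        rw [Complex.normSq_apply]
        simp
        nlinarith [mul_pos ha ha, mul_self_nonneg (x - a.re)]
      -- Undivided form of additivity of the logarithmic derivative: the root a contributes Im a /
      -- |x - a|².
      have h4 : ((g + (x - a) * g') * ((starRingEnd ℂ) (x - a) * (starRingEnd ℂ) g)).im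
          = Complex.normSq g * a.im + Complex.normSq (x - a) * (g' * (starRingEnd ℂ) g).im := by
        simp [Complex.normSq_apply]
        ring
      have h5 := add_pos_of_pos_of_nonneg (mul_pos h1 ha) (mul_nonneg h3.le h2)
      rw [h4]
      exact ⟨mul_pos h3 h1, h5.le, fun _ => h5⟩
  exact (key _ hs).2.2 hne

/-! ### Partial fractions with positive residues -/

/-- The partial fraction expansion of `r / q`, for `q` with simple real roots only. -/
theorem aeval_eq_mul_sum_inv {q r : ℝ[X]} {s : Finset ℝ} (hq : q = ∏ μ ∈ s, (X - C μ))
    (hr : r.degree < s.card) {z : ℂ} (hz : aeval z q ≠ 0) :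
    aeval z r = aeval z q *
      ∑ μ ∈ s, ((r.eval μ / q.derivative.eval μ : ℝ) : ℂ) * (z - (μ : ℂ))⁻¹ := by
  have hN : q.map Complex.ofRealHom = Lagrange.nodal s (fun μ : ℝ => (μ : ℂ)) := by
    rw [hq, Polynomial.map_prod, Lagrange.nodal_eq]
    simp
  have hE := fun p : ℝ[X] => (eval_map_complex_ofRealHom p z).symm
  have hx := fun (p : ℝ[X]) (x : ℝ) =>
    (eval_map_complex_ofRealHom p x).trans (aeval_complex_ofReal p x)
  have hinj : Set.InjOn (fun μ : ℝ => (μ : ℂ)) s := Complex.ofReal_injective.injOn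
  have hzs : ∀ μ ∈ s, z ≠ (μ : ℂ) := by
    rintro μ hμ rfl
    apply hz
    rw [hE, hN]
    exact Lagrange.eval_nodal_at_node hμ
  have hdeg : (r.map Complex.ofRealHom).degree < s.card :=
    degree_map_le.trans_lt hr
  rw [hE, hE, Lagrange.eq_interpolate hinj hdeg, Lagrange.eval_interpolate_not_at_node _ hzs, hN]
  congr 1
  apply Finset.sum_congr rfl
  intro μ hμ
  rw [Lagrange.nodalWeight_eq_eval_derivative_nodal hμ, ← hN, derivative_map, hx, hx]
  push_cast
  ring

/-- Both sides are the coefficient of 1/z at infinity of r/q; positive residues thus force a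
positive top coefficient. -/
theorem coeff_eq_sum_eval_div_derivative {q r : ℝ[X]} {s : Finset ℝ}
    (hq : q = ∏ μ ∈ s, (X - C μ)) (hr : r.degree < s.card) :
    r.coeff (s.card - 1) = ∑ μ ∈ s, r.eval μ / q.derivative.eval μ := by
  have hN : q = Lagrange.nodal s id := by rw [hq, Lagrange.nodal_eq]; rfl
  rw [Lagrange.coeff_eq_sum (v := id) Function.injective_id.injOn hr]
  apply Finset.sum_congr rfl
  intro μ hμ
  have h := Lagrange.eval_nodal_derivative_eval_node_eq (v := id) hμ
  rw [Lagrange.eval_nodal, ← hN] at h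
  simp only [id] at *
  rw [h]

/-- A monic real polynomial with simple real roots only is the product over its root set. -/
theorem exists_finset_eq_prod_of_real_simple_roots {q : ℝ[X]} (hq : q.Monic)
    (h1 : ∀ z : ℂ, aeval z q = 0 → z.im = 0)
    (h2 : ∀ x : ℝ, q.eval x = 0 → q.derivative.eval x ≠ 0) :
    ∃ s : Finset ℝ, q = ∏ μ ∈ s, (X - C μ) ∧ ∀ μ ∈ s, q.eval μ = 0 := by
  have hs : q.Splits := by
    apply Splits.of_splits_map Complex.ofRealHom (IsAlgClosed.splits _)
    intro a ha
    have h3 : aeval a q = 0 := by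
      rw [← eval_map_complex_ofRealHom]
      exact isRoot_of_mem_roots ha
    exact ⟨a.re, Complex.ext (by simp) (by simp [h1 a h3])⟩
  have hn : q.roots.Nodup := by
    rw [Multiset.nodup_iff_count_le_one]
    intro a
    rw [count_roots]
    by_contra! h
    rw [one_lt_rootMultiplicity_iff_isRoot hq.ne_zero] at h
    exact h2 a h.1 h.2
  refine ⟨⟨q.roots, hn⟩, hs.eq_prod_roots_of_monic hq, fun μ hμ => ?_⟩
  exact isRoot_of_mem_roots (Finset.mem_mk.1 hμ)

/-- If `r / q` has simple real poles with positive residues only, then its leading coefficient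
is positive and the roots of `q - i t r`, `t > 0`, lie in the upper half-plane. -/
theorem im_pos_of_residues_pos {n : ℕ} {q r : ℝ[X]} (hq : q.Monic) (hd : q.natDegree = n + 1)
    (hr : r.degree < (n + 1 : ℕ)) (h1 : ∀ z : ℂ, aeval z q = 0 → z.im = 0)
    (h2 : ∀ x : ℝ, q.eval x = 0 → 0 < r.eval x * q.derivative.eval x) :
    0 < r.coeff n ∧ ∀ t : ℝ, 0 < t → ∀ z : ℂ, aeval z q = Complex.I * t * aeval z r →
      0 < z.im := by
  obtain ⟨s, hs, hroot⟩ := exists_finset_eq_prod_of_real_simple_roots hq h1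
    (fun x hx h => by have := h2 x hx; simp [h] at this)
  have hcard : s.card = n + 1 := by
    rw [← hd, hs, natDegree_prod_of_monic _ _ (fun μ _ => monic_X_sub_C μ)]; simp
  have hpos : ∀ μ ∈ s, 0 < r.eval μ / q.derivative.eval μ := by
    intro μ hμ
    have := h2 μ (hroot μ hμ)
    rcases mul_pos_iff.1 this with h | h
    · exact div_pos h.1 h.2
    · exact div_pos_of_neg_of_neg h.1 h.2
  rw [← hcard] at hr
  constructor
  · have := coeff_eq_sum_eval_div_derivative hs hr
    rw [hcard, Nat.add_sub_cancel] at this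
    rw [this]
    exact Finset.sum_pos hpos (Finset.card_pos.1 (by omega))
  · intro t ht z hz
    by_contra! him
    by_cases hqz : aeval z q = 0
    · obtain ⟨x, rfl⟩ : ∃ x : ℝ, (x : ℂ) = z :=
        ⟨z.re, Complex.ext (by simp) (by simp [h1 z hqz])⟩
      rw [hqz, aeval_complex_ofReal] at hz
      rw [aeval_complex_ofReal, Complex.ofReal_eq_zero] at hqz
      have h3 : r.eval x = 0 := by simpa [ht.ne'] using hz
      simpa [h3] using h2 x hqz
    · rw [aeval_eq_mul_sum_inv hs hr hqz] at hz
      have h3 : 1 = Complex.I * t *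
          ∑ μ ∈ s, ((r.eval μ / q.derivative.eval μ : ℝ) : ℂ) * (z - (μ : ℂ))⁻¹ := by
        apply mul_left_cancel₀ hqz
        linear_combination hz
      have h4 := congrArg Complex.re h3
      rw [Finset.mul_sum, Complex.re_sum, Complex.one_re] at h4
      -- Each term has real part t c Im z / |z - μ|², so for Im z ≤ 0 the terms cannot sum to 1.
      have h5 : ∀ μ ∈ s, (Complex.I * t * (((r.eval μ / q.derivative.eval μ : ℝ) : ℂ) *
          (z - (μ : ℂ))⁻¹)).re ≤ 0 := by
        intro μ hμ
        have h6 := hpos μ hμ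
        generalize r.eval μ / q.derivative.eval μ = c at *
        have h7 : (Complex.I * t * ((c : ℂ) * (z - (μ : ℂ))⁻¹)).re
            = t * c * (z.im / Complex.normSq (z - μ)) := by
          simp
          ring
        rw [h7]
        exact mul_nonpos_of_nonneg_of_nonpos (by positivity)
          (div_nonpos_of_nonpos_of_nonneg him (Complex.normSq_nonneg _))
      linarith [Finset.sum_nonpos h5]

/-! ### Constructing the Jacobi matrix from a pair of polynomials -/

/-- One Euclidean step p = (X - b)q - r. Hermite–Biehler makes the residues of r/q positive, so the
leading coefficient c of r can serve as a², and (q, r/c) inherits the hypothesis with l = 1. -/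
theorem exists_isStrictJacobi {n : ℕ} {p q : ℝ[X]} (hp : p.Monic) (hpd : p.natDegree = n + 1)
    (hq : q.Monic) (hqd : q.natDegree = n) {l : ℝ} (hl : 0 < l)
    (h : ∀ z : ℂ, aeval z p = Complex.I * l * aeval z q → 0 < z.im) :
    ∃ J : Matrix (Fin (n + 1)) (Fin (n + 1)) ℝ,
      IsStrictJacobi J ∧ J.charpoly = p ∧ J.tail.charpoly = q := by
  induction n generalizing p q l with
  | zero =>
    obtain rfl := hq.natDegree_eq_zero.1 hqd
    refine ⟨Matrix.of fun _ _ => -p.coeff 0, ⟨⟨?_, ?_, ?_⟩, ?_⟩, ?_, ?_⟩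
    · ext; simp
    · intro i j; omega
    · intro i j; omega
    · intro i j; omega
    · rw [charpoly_fin_one]
      conv_rhs => rw [hp.eq_X_add_C hpd]
      simp
    · simp [Matrix.charpoly]
  | succ n ih =>
    set f : ℂ[X] := p.map Complex.ofRealHom - C (Complex.I * l) * q.map Complex.ofRealHom with hf
    have hdeg : (C (Complex.I * (l : ℂ)) * q.map Complex.ofRealHom).degree
        < (p.map Complex.ofRealHom).degree := by
      rw [degree_C_mul (by simp [hl.ne']), degree_map, degree_map, degree_eq_natDegree hp.ne_zero, degree_eq_natDegree hq.ne_zero,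
        hpd, hqd]
      exact_mod_cast Nat.lt_succ_self _
    have hE := eval_map_complex_ofRealHom
    have hx := aeval_complex_ofReal
    have hfe : ∀ z, f.eval z = aeval z p - Complex.I * l * aeval z q := by
      intro z; simp [hf, hE]
    have hfm : f.Monic := (hp.map _).sub_of_left hdeg
    have hfd : f.natDegree ≠ 0 := by
      rw [hf, natDegree_eq_of_degree_eq (degree_sub_eq_left_of_degree_lt hdeg), natDegree_map,
        hpd]
      omega
    have hfr : ∀ w, f.IsRoot w → 0 < w.im := by
      intro w hw
      rw [IsRoot, hfe, sub_eq_zero] at hw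
      exact h w hw
    -- Where q vanishes, f takes conjugate values p(z) and p(z̄), of equal modulus.
    have hq0 : ∀ z : ℂ, aeval z q = 0 → ¬ 0 < z.im := by
      intro z hz him
      have := norm_eval_lt_norm_eval_conj hfm hfd hfr him
      rw [hfe, hfe, aeval_conj, aeval_conj, hz] at this
      simp at this
    have hq1 : ∀ z : ℂ, aeval z q = 0 → z.im = 0 := by
      intro z hz
      have h1 := hq0 z hz
      have h2 := hq0 ((starRingEnd ℂ) z) (by rw [aeval_conj, hz, map_zero])
      rw [Complex.conj_im] at h2
      linarith
    -- At a real root of q, Im (f' f̄) reduces to -l p q'.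
    have hw : ∀ x : ℝ, q.eval x = 0 → 0 < -p.eval x * q.derivative.eval x := by
      intro x hx0
      have h1 := im_eval_derivative_mul_conj_pos hfm hfd hfr x
      have h2 : f.derivative.eval (x : ℂ)
          = (p.derivative.eval x : ℝ) - Complex.I * l * (q.derivative.eval x : ℝ) := by
        rw [← hx, ← hx, ← hE, ← hE, hf]
        simp [derivative_map]
      rw [h2, hfe, hx, hx, hx0] at h1
      simp at h1
      nlinarith [h1]
    -- This b cancels the coefficient of X^(n+1) in (X - b)q - p; that of X^(n+2) cancels because p
    -- and q are monic.
    set b : ℝ := q.coeff n - p.coeff (n + 1) with hb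
    set r : ℝ[X] := (X - C b) * q - p with hr
    have hqc : q.coeff (n + 1) = 1 := by rw [← hqd]; exact hq
    have hpc : p.coeff (n + 2) = 1 := by
      have : p.coeff p.natDegree = 1 := hp
      rwa [hpd] at this
    have hrd : r.degree < (n + 1 : ℕ) := by
      rw [degree_lt_iff_coeff_zero]
      intro m hm
      obtain ⟨k, rfl⟩ : ∃ k, m = k + 1 := ⟨m - 1, by omega⟩
      rw [hr, sub_mul, coeff_sub, coeff_sub, coeff_X_mul, coeff_C_mul]
      rcases Nat.lt_or_ge n k with hk | hk
      · rw [coeff_eq_zero_of_natDegree_lt (show q.natDegree < k + 1 by omega)]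
        rcases Nat.lt_or_ge (n + 1) k with hk' | hk'
        · rw [coeff_eq_zero_of_natDegree_lt (show q.natDegree < k by omega),
            coeff_eq_zero_of_natDegree_lt (show p.natDegree < k + 1 by omega)]
          simp
        · obtain rfl : k = n + 1 := by omega
          rw [hqc, hpc]; simp
      · obtain rfl : k = n := by omega
        rw [hqc, hb]; ring
    obtain ⟨hc, hroots⟩ := im_pos_of_residues_pos hq hqd hrd hq1 (by
      intro x hx0
      have h1 : r.eval x = -p.eval x := by simp [hr, hx0]
      rw [h1]
      exact hw x hx0)
    set c := r.coeff n with hcdef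
    have hrn : r.natDegree = n := by
      apply le_antisymm
      · apply Nat.lt_succ_iff.1
        exact (natDegree_lt_iff_degree_lt (by rintro h0; simp [hcdef, h0] at hc)).2 hrd
      · exact le_natDegree_of_ne_zero hc.ne'
    have hm : (C c⁻¹ * r).Monic := by
      apply monic_C_mul_of_mul_leadingCoeff_eq_one
      rw [leadingCoeff, hrn]
      exact inv_mul_cancel₀ hc.ne'
    obtain ⟨J, hJ, hJq, hJr⟩ := ih hq hqd hm
      (by rw [natDegree_C_mul (inv_ne_zero hc.ne'), hrn]) one_pos (by
        intro z hz
        apply hroots c⁻¹ (inv_pos.2 hc) z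
        rw [hz]
        simp
        ring)
    obtain ⟨K, hK, hKJ, hK0, hK1⟩ := hJ.exists_border b (Real.sqrt_pos.2 hc)
    refine ⟨K, hK, ?_, by rw [hKJ, hJq]⟩
    rw [hK.charpoly_eq, hKJ, hJq, hJr, hK0, hK1, Real.sq_sqrt hc.le, ← mul_assoc, ← C_mul,
      mul_inv_cancel₀ hc.ne', hr]
    simp

/-! ### The total argument along the real line -/

section ArgSum

variable {ι : Type*} [Fintype ι]

/-- The total argument of the points `z j` as seen from the real point `x`. -/
noncomputable def argSum (z : ι → ℂ) (x : ℝ) : ℝ := ∑ j, (z j - x).arg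

/-- Both arguments lie in [0, π], and the sine of their difference is -x Im z / (|z| |z - x|) < 0.
-/
theorem Complex.arg_lt_arg_sub_ofReal {z : ℂ} (hz : 0 < z.im) {x : ℝ} (hx : 0 < x) :
    z.arg < (z - x).arg := by
  have h1 : 0 < (z - x).im := by simpa using hz
  have hz0 : 0 < ‖z‖ := norm_pos_iff.2 (by rintro rfl; simp at hz)
  have hzx : 0 < ‖z - x‖ := norm_pos_iff.2 (by intro h; simp [h] at h1)
  by_contra! h
  have h2 : 0 ≤ Real.sin (z.arg - (z - x).arg) :=
    Real.sin_nonneg_of_nonneg_of_le_pi (by linarith)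
      (by linarith [Complex.arg_le_pi z, Complex.arg_nonneg_iff.2 h1.le])
  rw [Real.sin_sub, Complex.sin_arg, Complex.sin_arg,
    Complex.cos_arg (norm_pos_iff.1 hz0), Complex.cos_arg (norm_pos_iff.1 hzx)] at h2
  have h3 : z.im / ‖z‖ * ((z - x).re / ‖z - x‖) - z.re / ‖z‖ * ((z - x).im / ‖z - x‖)
      = -(x * z.im) / (‖z‖ * ‖z - x‖) := by
    field_simp
    simp
    ring
  rw [h3] at h2
  exact absurd h2 (not_le.2 (div_neg_of_neg_of_pos (by nlinarith [mul_pos hx hz]) (by positivity)))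

variable {z : ι → ℂ}

theorem strictMono_argSum [Nonempty ι] (hz : ∀ j, 0 < (z j).im) : StrictMono (argSum z) := by
  intro x y hxy
  refine Finset.sum_lt_sum_of_nonempty Finset.univ_nonempty fun j _ => ?_
  have h := Complex.arg_lt_arg_sub_ofReal (z := z j - x) (by simpa using hz j) (sub_pos.2 hxy)
  rwa [show z j - (x : ℂ) - ((y - x : ℝ) : ℂ) = z j - y by push_cast; ring] at h

theorem argSum_nonneg (hz : ∀ j, 0 < (z j).im) (x : ℝ) : 0 ≤ argSum z x :=
  Finset.sum_nonneg fun j _ => Complex.arg_nonneg_iff.2 (by simpa using (hz j).le)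

theorem continuous_argSum (hz : ∀ j, 0 < (z j).im) : Continuous (argSum z) := by
  refine continuous_finsetSum _ fun j _ => continuous_iff_continuousAt.2 fun x => ?_
  refine ContinuousAt.comp (g := Complex.arg) (Complex.continuousAt_arg ?_) (by fun_prop)
  exact Or.inr (by simpa using (hz j).ne')

/-- For x < 0 the positive factor -x does not affect the argument, leaving arg (1 - z_j/x) → arg 1.
-/
theorem tendsto_argSum_atBot : Tendsto (argSum z) atBot (𝓝 0) := by
  have h : Tendsto (argSum z) atBot (𝓝 (∑ _j : ι, (0 : ℝ))) := by
    refine tendsto_finsetSum _ fun j _ => ?_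
    have h1 : Tendsto (fun x : ℝ => 1 - z j * ((x⁻¹ : ℝ) : ℂ)) atBot (𝓝 (1 - z j * ((0 : ℝ) : ℂ))) :=
      tendsto_const_nhds.sub (tendsto_const_nhds.mul
        ((Complex.continuous_ofReal.tendsto 0).comp tendsto_inv_atBot_zero))
    have h2 : Tendsto Complex.arg (𝓝 (1 - z j * ((0 : ℝ) : ℂ))) (𝓝 0) := by
      have := (Complex.continuousAt_arg (x := 1) (by simp)).tendsto
      simpa using this
    refine (h2.comp h1).congr' ?_
    filter_upwards [eventually_lt_atBot 0] with x hx
    have h3 : z j - x = ((-x : ℝ) : ℂ) * (1 - z j * ((x⁻¹ : ℝ) : ℂ)) := by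
      have : (x : ℂ) ≠ 0 := by exact_mod_cast hx.ne
      push_cast
      field_simp
      ring
    rw [h3, Complex.arg_real_mul _ (neg_pos.2 hx)]
    rfl
  simpa using h

theorem re_prod_sub_ofReal (z : ι → ℂ) (x : ℝ) :
    (∏ j, (z j - x)).re = (∏ j, ‖z j - x‖) * Real.cos (argSum z x) := by
  have h : ∏ j, (z j - x) = ((∏ j, ‖z j - x‖ : ℝ) : ℂ) * Complex.exp (argSum z x * Complex.I) := by
    rw [argSum, Complex.ofReal_sum, Finset.sum_mul, Complex.exp_sum, Complex.ofReal_prod,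
      ← Finset.prod_mul_distrib]
    exact Finset.prod_congr rfl fun j _ => (Complex.norm_mul_exp_arg_mul_I _).symm
  rw [h, Complex.re_ofReal_mul, Complex.exp_ofReal_mul_I_re]

theorem re_prod_ofReal_sub_eq_zero_iff (hz : ∀ j, 0 < (z j).im) (x : ℝ) :
    (∏ j, ((x : ℂ) - z j)).re = 0 ↔ Real.cos (argSum z x) = 0 := by
  have h1 : ∏ j, ((x : ℂ) - z j)
      = (((-1) ^ Fintype.card ι : ℝ) : ℂ) * ∏ j, (z j - x) := by
    push_cast
    rw [← Finset.card_univ, ← Finset.prod_const, ← Finset.prod_mul_distrib]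
    exact Finset.prod_congr rfl fun j _ => by ring
  have h2 : (∏ j, ‖z j - x‖) ≠ 0 := by
    refine Finset.prod_ne_zero_iff.2 fun j _ => norm_ne_zero_iff.2 fun h => ?_
    have := congrArg Complex.im h
    simp at this
    exact (hz j).ne' this
  rw [h1, Complex.re_ofReal_mul, re_prod_sub_ofReal]
  simp [h2]

theorem exists_argSum_eq_pi_div_two (hz : ∀ j, 0 < (z j).im) {y : ℝ} (hy : Real.pi / 2 ≤ argSum z y) :
    ∃ x ≤ y, argSum z x = Real.pi / 2 := by
  obtain ⟨w, hw, hwy⟩ := (((tendsto_argSum_atBot (z := z)).eventually (gt_mem_nhds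
    (show (0 : ℝ) < Real.pi / 2 by positivity))).and (eventually_le_atBot y)).exists
  obtain ⟨x, hx, hx'⟩ := intermediate_value_Icc hwy (continuous_argSum hz).continuousOn ⟨hw.le, hy⟩
  exact ⟨x, hx.2, hx'⟩

theorem cos_argSum_ne_zero (hz : ∀ j, 0 < (z j).im) {x : ℝ} (hx : argSum z x < Real.pi / 2) :
    Real.cos (argSum z x) ≠ 0 :=
  (Real.cos_pos_of_mem_Ioo ⟨by linarith [argSum_nonneg hz x, Real.pi_pos], hx⟩).ne'

end ArgSum

/-! ### Positivity and eigenvalue lists via characteristic polynomials -/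

theorem Matrix.IsHermitian.eval_charpoly_eq_zero_iff {n : Type*} [Fintype n] [DecidableEq n]
    {A : Matrix n n ℝ} (hA : A.IsHermitian) (x : ℝ) :
    A.charpoly.eval x = 0 ↔ ∃ i, hA.eigenvalues i = x := by
  rw [hA.charpoly_eq, eval_prod, Finset.prod_eq_zero_iff]
  simp only [Finset.mem_univ, true_and, eval_sub, eval_X, eval_C, sub_eq_zero,
    RCLike.ofReal_real_eq_id, id, eq_comm (a := x)]

theorem Matrix.IsHermitian.posDef_iff_eval_charpoly {n : Type*} [Fintype n] [DecidableEq n]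
    {A : Matrix n n ℝ} (hA : A.IsHermitian) :
    A.PosDef ↔ ∀ x ≤ 0, A.charpoly.eval x ≠ 0 := by
  simp only [hA.posDef_iff_eigenvalues_pos, ne_eq, hA.eval_charpoly_eq_zero_iff]
  constructor
  · rintro h x hx ⟨i, rfl⟩
    exact absurd (h i) (not_lt.2 hx)
  · intro h i
    by_contra! hi
    exact h _ hi ⟨i, rfl⟩

theorem Matrix.IsHermitian.posSemidef_iff_eval_charpoly {n : Type*} [Fintype n] [DecidableEq n]
    {A : Matrix n n ℝ} (hA : A.IsHermitian) :
    A.PosSemidef ↔ ∀ x < 0, A.charpoly.eval x ≠ 0 := by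
  simp only [hA.posSemidef_iff_eigenvalues_nonneg, ne_eq, hA.eval_charpoly_eq_zero_iff]
  constructor
  · rintro h x hx ⟨i, rfl⟩
    exact absurd (h i) (not_le.2 hx)
  · intro h i
    by_contra! hi
    exact h _ hi ⟨i, rfl⟩

theorem Matrix.det_eq_zero_iff_eval_charpoly {n : Type*} [Fintype n] [DecidableEq n]
    (A : Matrix n n ℝ) : A.det = 0 ↔ A.charpoly.eval 0 = 0 := by
  rw [Matrix.det_eq_sign_charpoly_coeff, coeff_zero_eq_eval_zero]
  simp

theorem isEigenvalueSystem_iff {n : ℕ} (M : Matrix (Fin n) (Fin n) ℂ) (z : Fin n → ℂ) :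
    IsEigenvalueSystem M z ↔ M.charpoly = ∏ j, (X - C (z j)) := by
  unfold IsEigenvalueSystem
  constructor
  · intro h
    rw [(IsAlgClosed.splits M.charpoly).eq_prod_roots_of_monic M.charpoly_monic, h,
      Multiset.map_map]
    rfl
  · intro h
    rw [h, ← roots_multiset_prod_X_sub_C (Finset.univ.val.map z), Multiset.map_map]
    rfl

theorem exists_isEigenvalueSystem {n : ℕ} (M : Matrix (Fin n) (Fin n) ℂ) :
    ∃ z : Fin n → ℂ, IsEigenvalueSystem M z := by
  have hc : M.charpoly.roots.card = n := by
    rw [← (IsAlgClosed.splits _).natDegree_eq_card_roots, Matrix.charpoly_natDegree_eq_dim,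
      Fintype.card_fin]
  unfold IsEigenvalueSystem
  generalize M.charpoly.roots = s at hc ⊢
  induction s using Quotient.inductionOn with
  | h L =>
    obtain rfl : L.length = n := hc
    exact ⟨L.get, by rw [Fin.univ_val_map, List.ofFn_get]; rfl⟩

/-! ### The spectral correspondence -/

section Models

variable {n : ℕ} {J : Matrix (Fin (n + 1)) (Fin (n + 1)) ℝ} {l : ℝ} {z : Fin (n + 1) → ℂ}

theorem IsStrictJacobi.im_pos_of_isEigenvalueSystem (hJ : IsStrictJacobi J) (hl : 0 < l)
    (h : IsEigenvalueSystem (jacobiPerturbation J l) z) (j : Fin (n + 1)) : 0 < (z j).im := by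
  refine hJ.im_pos_of_isRoot hl ?_
  rw [(isEigenvalueSystem_iff _ _).1 h, IsRoot, eval_prod]
  exact Finset.prod_eq_zero (Finset.mem_univ j) (by simp)

/-- On the real line P is the real part of P - ilQ = ∏ (x - z_j), so the eigenvalues of `J` sit
where the total argument is an odd multiple of π/2. -/
theorem eval_charpoly_eq_zero_iff_cos_argSum (hz : ∀ j, 0 < (z j).im)
    (h : IsEigenvalueSystem (jacobiPerturbation J l) z) (x : ℝ) :
    J.charpoly.eval x = 0 ↔ Real.cos (argSum z x) = 0 := by
  rw [← re_prod_ofReal_sub_eq_zero_iff hz]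
  have h1 := congrArg (eval (x : ℂ)) ((isEigenvalueSystem_iff _ _).1 h)
  rw [eval_charpoly_jacobiPerturbation, eval_prod, aeval_complex_ofReal,
    aeval_complex_ofReal] at h1
  simp only [eval_sub, eval_X, eval_C] at h1
  rw [← h1]
  simp

/-- By monotonicity, a value below π/2 at 0 excludes eigenvalues x ≤ 0; otherwise the level π/2 is
reached at some x ≤ 0, an eigenvalue. -/
theorem posDef_iff_argSum_lt (hJ : IsStrictJacobi J) (hz : ∀ j, 0 < (z j).im)
    (h : IsEigenvalueSystem (jacobiPerturbation J l) z) :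
    J.PosDef ↔ ∑ j, (z j).arg < Real.pi / 2 := by
  have hH : J.IsHermitian := hJ.1.symm
  have h0 : ∑ j, (z j).arg = argSum z 0 := by simp [argSum]
  rw [hH.posDef_iff_eval_charpoly, h0]
  simp only [ne_eq, eval_charpoly_eq_zero_iff_cos_argSum hz h]
  constructor
  · intro hx
    by_contra! hy
    obtain ⟨x, hx0, hx'⟩ := exists_argSum_eq_pi_div_two hz hy
    exact hx x hx0 (by rw [hx', Real.cos_pi_div_two])
  · intro hx x hx0
    exact cos_argSum_ne_zero hz (((strictMono_argSum hz).monotone hx0).trans_lt hx)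

theorem posSemidef_and_det_eq_zero_iff_argSum_eq (hJ : IsStrictJacobi J)
    (hz : ∀ j, 0 < (z j).im) (h : IsEigenvalueSystem (jacobiPerturbation J l) z) :
    (J.PosSemidef ∧ J.det = 0) ↔ ∑ j, (z j).arg = Real.pi / 2 := by
  have hH : J.IsHermitian := hJ.1.symm
  have h0 : ∑ j, (z j).arg = argSum z 0 := by simp [argSum]
  rw [hH.posSemidef_iff_eval_charpoly, Matrix.det_eq_zero_iff_eval_charpoly, h0]
  simp only [ne_eq, eval_charpoly_eq_zero_iff_cos_argSum hz h]
  constructor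
  · rintro ⟨hx, hd⟩
    by_contra hne
    rcases lt_or_gt_of_ne hne with hlt | hgt
    · exact cos_argSum_ne_zero hz hlt hd
    · obtain ⟨x, hx0, hx'⟩ := exists_argSum_eq_pi_div_two hz hgt.le
      have hx1 : x ≠ 0 := by rintro rfl; exact hne hx'
      exact hx x (lt_of_le_of_ne hx0 hx1) (by rw [hx', Real.cos_pi_div_two])
  · intro hx
    refine ⟨fun x hx0 => cos_argSum_ne_zero hz ?_, by rw [hx, Real.cos_pi_div_two]⟩
    rw [← hx]
    exact strictMono_argSum hz hx0

/-- Splitting a complex polynomial into its real and imaginary parts. -/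
theorem Polynomial.exists_eq_re_sub_I_mul_im (f : ℂ[X]) : ∃ p r : ℝ[X],
    f = p.map Complex.ofRealHom - C Complex.I * r.map Complex.ofRealHom := by
  induction f using Polynomial.induction_on' with
  | add f g hf hg =>
    obtain ⟨p, r, rfl⟩ := hf
    obtain ⟨p', r', rfl⟩ := hg
    exact ⟨p + p', r + r', by simp; ring⟩
  | monomial k a =>
    refine ⟨monomial k a.re, monomial k (-a.im), ?_⟩
    simp only [map_monomial, C_mul_monomial, ← monomial_sub]
    congr 1
    apply Complex.ext <;> simp

theorem re_coeff_map_sub_I_mul_map (p r : ℝ[X]) (k : ℕ) :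
    ((p.map Complex.ofRealHom - C Complex.I * r.map Complex.ofRealHom).coeff k).re = p.coeff k := by
  simp [coeff_C_mul]

theorem im_coeff_map_sub_I_mul_map (p r : ℝ[X]) (k : ℕ) :
    ((p.map Complex.ofRealHom - C Complex.I * r.map Complex.ofRealHom).coeff k).im
      = -r.coeff k := by
  simp [coeff_C_mul]

/-- Existence needs only the upper half-plane; the argument condition merely selects the sign of
`J`. Splitting ∏ (X - z_j) into p - ir gives P = p, l the top coefficient of r, and Q = r/l. -/
theorem exists_isStrictJacobi_isEigenvalueSystem (hz : ∀ j, 0 < (z j).im) :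
    ∃ (J : Matrix (Fin (n + 1)) (Fin (n + 1)) ℝ) (l : ℝ), IsStrictJacobi J ∧ 0 < l ∧
      IsEigenvalueSystem (jacobiPerturbation J l) z := by
  set f : ℂ[X] := ∏ j, (X - C (z j)) with hf
  obtain ⟨p, r, hpr⟩ := f.exists_eq_re_sub_I_mul_im
  have hfm : f.Monic := monic_prod_of_monic _ _ fun j _ => monic_X_sub_C _
  have hfd : f.natDegree = n + 1 := by
    rw [hf, natDegree_prod_of_monic _ _ fun j _ => monic_X_sub_C _]; simp
  have hpc : ∀ k, p.coeff k = (f.coeff k).re := fun k => by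
    rw [hpr, re_coeff_map_sub_I_mul_map]
  have hrc : ∀ k, r.coeff k = -(f.coeff k).im := fun k => by
    rw [hpr, im_coeff_map_sub_I_mul_map, neg_neg]
  have hf1 : f.coeff (n + 1) = 1 := by rw [← hfd]; exact hfm
  have hp1 : p.coeff (n + 1) = 1 := by simp [hpc, hf1]
  have hpd : p.natDegree ≤ n + 1 := natDegree_le_iff_coeff_eq_zero.2 fun k hk => by
    rw [hpc, coeff_eq_zero_of_natDegree_lt (by omega), Complex.zero_re]
  have hrd : r.natDegree ≤ n := natDegree_le_iff_coeff_eq_zero.2 fun k hk => by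
    rcases Nat.lt_or_ge (n + 1) k with h | h
    · rw [hrc, coeff_eq_zero_of_natDegree_lt (by omega)]; simp
    · obtain rfl : k = n + 1 := by omega
      rw [hrc, hf1]; simp
  set l : ℝ := r.coeff n with hl
  -- By Vieta, l = ∑ Im z_j.
  have hl0 : 0 < l := by
    have h1 := prod_X_sub_C_coeff_card_pred Finset.univ z (by simp)
    rw [Finset.card_univ, Fintype.card_fin, Nat.add_sub_cancel, ← hf] at h1
    rw [hl, hrc, h1]
    simp only [Complex.neg_im, neg_neg, Complex.im_sum]
    exact Finset.sum_pos (fun j _ => hz j) Finset.univ_nonempty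
  have hpm : p.Monic := monic_of_natDegree_le_of_coeff_eq_one _ hpd hp1
  have hqm : (C l⁻¹ * r).Monic := by
    refine monic_of_natDegree_le_of_coeff_eq_one n ((natDegree_C_mul_le _ _).trans hrd) ?_
    rw [coeff_C_mul, ← hl, inv_mul_cancel₀ hl0.ne']
  have hpd' : p.natDegree = n + 1 :=
    le_antisymm hpd (le_natDegree_of_ne_zero (by simp [hp1]))
  have hqd : (C l⁻¹ * r).natDegree = n := by
    rw [natDegree_C_mul (inv_ne_zero hl0.ne')]
    exact le_antisymm hrd (le_natDegree_of_ne_zero hl0.ne')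
  have hlq : C (Complex.I * (l : ℂ)) * (C l⁻¹ * r).map Complex.ofRealHom
      = C Complex.I * r.map Complex.ofRealHom := by
    have : (l : ℂ) ≠ 0 := by exact_mod_cast hl0.ne'
    rw [Polynomial.map_mul, map_C, ← mul_assoc, ← C_mul]
    congr 2
    simp [this]
  obtain ⟨J, hJ, hJp, hJq⟩ := exists_isStrictJacobi hpm hpd' hqm hqd hl0 (by
    intro w hw
    have h1 : f.eval w = 0 := by
      rw [hpr, ← hlq, eval_sub, eval_mul, eval_C, eval_map_complex_ofRealHom,
        eval_map_complex_ofRealHom, hw, sub_self]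
    rw [hf, eval_prod, Finset.prod_eq_zero_iff] at h1
    obtain ⟨j, -, hj⟩ := h1
    have : w = z j := by simpa [sub_eq_zero] using hj
    rw [this]
    exact hz j)
  refine ⟨J, l, hJ, hl0, (isEigenvalueSystem_iff _ _).2 ?_⟩
  rw [charpoly_jacobiPerturbation, hJp, hJq, hlq, ← hpr]

theorem jacobiPerturbation_eq_of_charpoly_eq {K : Matrix (Fin (n + 1)) (Fin (n + 1)) ℝ} {m : ℝ}
    (hJ : IsStrictJacobi J) (hK : IsStrictJacobi K) (hl : 0 < l)
    (h : (jacobiPerturbation J l).charpoly = (jacobiPerturbation K m).charpoly) :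
    jacobiPerturbation J l = jacobiPerturbation K m := by
  have key : ∀ (A : Matrix (Fin (n + 1)) (Fin (n + 1)) ℝ) (t : ℝ),
      (jacobiPerturbation A t).charpoly = A.charpoly.map Complex.ofRealHom
        - C Complex.I * (C t * A.tail.charpoly).map Complex.ofRealHom := by
    intro A t
    rw [charpoly_jacobiPerturbation, Polynomial.map_mul, map_C, C_mul, mul_assoc]
    rfl
  rw [key, key] at h
  have h1 : J.charpoly = K.charpoly := by
    ext k
    rw [← re_coeff_map_sub_I_mul_map _ (C l * J.tail.charpoly), h, re_coeff_map_sub_I_mul_map]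
  have h2 : C l * J.tail.charpoly = C m * K.tail.charpoly := by
    ext k
    rw [← neg_inj, ← im_coeff_map_sub_I_mul_map J.charpoly, h, im_coeff_map_sub_I_mul_map]
  have h3 : l = m := by
    simpa [(Matrix.charpoly_monic _).leadingCoeff] using congrArg leadingCoeff h2
  subst h3
  rw [hJ.eq_of_charpoly_eq hK h1 (mul_left_cancel₀ (by simpa using hl.ne') h2)]

end Models

theorem proposition4p3 :
    (∀ n : ℕ, 1 ≤ n →
      (∀ M ∈ definiteModels n,
        (∃ z : Fin n → ℂ, IsEigenvalueSystem M z) ∧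
          ∀ z : Fin n → ℂ, IsEigenvalueSystem M z → z ∈ configLT n) ∧
      (∀ z ∈ configLT n,
        ∃! M : Matrix (Fin n) (Fin n) ℂ, M ∈ definiteModels n ∧ IsEigenvalueSystem M z)) ∧
    (∀ m : ℕ,
      (∀ M ∈ singularModels (m + 1),
        (∃ z : Fin (m + 1) → ℂ, IsEigenvalueSystem M z) ∧
          ∀ z : Fin (m + 1) → ℂ, IsEigenvalueSystem M z → z ∈ configEQ (m + 1)) ∧
      (∀ z ∈ configEQ (m + 1),
        ∃! M : Matrix (Fin (m + 1)) (Fin (m + 1)) ℂ,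
          M ∈ singularModels (m + 1) ∧ IsEigenvalueSystem M z)) := by
  refine ⟨fun n hn => ?_, fun m => ⟨?_, ?_⟩⟩
  · obtain ⟨n, rfl⟩ : ∃ k, n = k + 1 := ⟨n - 1, by omega⟩
    refine ⟨?_, ?_⟩
    · rintro _ ⟨J, l, hJ, hpos, hl, rfl⟩
      refine ⟨exists_isEigenvalueSystem _, fun z h => ?_⟩
      have hz := hJ.im_pos_of_isEigenvalueSystem hl h
      exact ⟨hz, (posDef_iff_argSum_lt hJ hz h).1 hpos⟩
    · rintro z ⟨hz, hsum⟩
      obtain ⟨J, l, hJ, hl, h⟩ := exists_isStrictJacobi_isEigenvalueSystem hz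
      refine ⟨_, ⟨⟨J, l, hJ, (posDef_iff_argSum_lt hJ hz h).2 hsum, hl, rfl⟩, h⟩, ?_⟩
      rintro _ ⟨⟨K, t, hK, -, ht, rfl⟩, h'⟩
      exact jacobiPerturbation_eq_of_charpoly_eq hK hJ ht
        (((isEigenvalueSystem_iff _ _).1 h').trans ((isEigenvalueSystem_iff _ _).1 h).symm)
  · rintro _ ⟨J, l, hJ, hpos, hdet, hl, rfl⟩
    refine ⟨exists_isEigenvalueSystem _, fun z h => ?_⟩
    have hz := hJ.im_pos_of_isEigenvalueSystem hl h
    exact ⟨hz, (posSemidef_and_det_eq_zero_iff_argSum_eq hJ hz h).1 ⟨hpos, hdet⟩⟩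
  · rintro z ⟨hz, hsum⟩
    obtain ⟨J, l, hJ, hl, h⟩ := exists_isStrictJacobi_isEigenvalueSystem hz
    obtain ⟨hpos, hdet⟩ := (posSemidef_and_det_eq_zero_iff_argSum_eq hJ hz h).2 hsum
    refine ⟨_, ⟨⟨J, l, hJ, hpos, hdet, hl, rfl⟩, h⟩, ?_⟩
    rintro _ ⟨⟨K, t, hK, -, -, ht, rfl⟩, h'⟩
    exact jacobiPerturbation_eq_of_charpoly_eq hK hJ ht
      (((isEigenvalueSystem_iff _ _).1 h').trans ((isEigenvalueSystem_iff _ _).1 h).symm)
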